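/- Let $d\in\mathbb N$ and let $\mathcal P_2(\mathbb R^d)$ be the set of Borel probability measures on $\mathbb R^d$ with finite second moment. For $\mu,\nu\in\mathcal P_2(\mathbb R^d)$ let $\Gamma(\mu,\nu)$ be the set of nonnegative Borel measures on $\mathbb R^d\times\mathbb R^d$ with first marginal $\mu$ and second marginal $\nu$, let $W_2^2(\mu,\nu)=\inf_{\gamma\in\Gamma(\mu,\nu)}\int\|x-y\|^2\,d\gamma(x,y)$, with $W_2\ge 0$, and let $\Gamma_{\mathrm{opt}}(\mu,\nu)$ be the set of $\gamma\in\Gamma(\mu,\nu)$ that attain this infimum. A generalized geodesic between $\mu_0,\mu_1\in\mathcal P_2(\mathbb R^d)$ with base $\nu\in\mathcal P_2(\mathbb R^d)$ is a curve $\mu_t=((1-t)\pi^2+t\pi^3)_\#\gamma$, $t\in[0,1]$, where $\gamma$ is a measure on $(\mathbb R^d)^3$ with marginals $\nu,\mu_0,\mu_1$ such that $\pi^{1,2}_\#\gamma\in\Gamma_{\mathrm{opt}}(\nu,\mu_0)$ and $\pi^{1,3}_\#\gamma\in\Gamma_{\mathrm{opt}}(\nu,\mu_1)$; here $\pi^i$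 and $\pi^{i,j}$ are the coordinate projections. Let $\mathcal G:\mathcal P_2(\mathbb R^d)\to(-\infty,+\infty]$ be proper (not identically $+\infty$), lower semicontinuous with respect to $W_2$, and convex along generalized geodesics: for all $\mu_0,\mu_1,\nu\in\mathcal P_2(\mathbb R^d)$ there is a generalized geodesic $(\mu_s)_{s\in[0,1]}$ between $\mu_0$ and $\mu_1$ with base $\nu$ such that $\mathcal G(\mu_s)\le(1-s)\mathcal G(\mu_0)+s\,\mathcal G(\mu_1)$ for every $s\in[0,1]$ (with $0\cdot\infty=0$). Suppose that $\mathcal G$ attains its minimum over $\mathcal P_2(\mathbb R^d)$, and let $\tau>0$. Then: (i) For every $\mu\in\mathcal P_2(\mathbb R^d)$ the functional $\nu\mapsto\mathcal G(\nu)+\frac1{2\tau}W_2^2(\nu,\mu)$ has exactly one minimizer over $\mathcal P_2(\mathbb R^d)$, denoted by $J_\tau(\mu)$. (ii) For all $\mu,\nu\in\mathcal P_2(\mathbb R^d)$, $$W_2^2(J_\tau(\mu),\nu)-W_2^2(\mu,\nu)\le 2\tau\bigl(\mathcal G(\nu)-\mathcal G(J_\tau(\mu))\bigr)-W_2^2(J_\tau(\mu),\mu).$$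 (iii) If $\mu_n,\mu\in\mathcal P_2(\mathbb R^d)$ and $W_2(\mu_n,\mu)\to0$, then $W_2(J_\tau(\mu_n),J_\tau(\mu))\to0$. -/

import Mathlib

open MeasureTheory Filter Topology
open scoped ENNReal

namespace JKO

/-- The Euclidean space `ℝ^d`. -/
abbrev E (d : ℕ) : Type := EuclideanSpace ℝ (Fin d)

/-- `𝒫₂(ℝ^d)`: Borel probability measures on `ℝ^d` with finite second moment. -/
@[ext]
structure P2 (d : ℕ) where
  toMeasure : Measure (E d)
  isProb : IsProbabilityMeasure toMeasure
  moment : ∫⁻ x, ‖x‖ₑ ^ 2 ∂toMeasure < ∞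

/-- `Γ(μ, ν)`: the couplings (transport plans) between `μ` and `ν`. -/
def couplings {d : ℕ} (μ ν : P2 d) : Set (Measure (E d × E d)) :=
  {γ | γ.map Prod.fst = μ.toMeasure ∧ γ.map Prod.snd = ν.toMeasure}

/-- The quadratic transport cost `∫ ‖x - y‖² dγ(x, y)` of a plan. -/
noncomputable def cost {d : ℕ} (γ : Measure (E d × E d)) : ℝ≥0∞ :=
  ∫⁻ z, ‖z.1 - z.2‖ₑ ^ 2 ∂γ

/-- `Γ_opt(μ, ν)`: the optimal transport plans. -/
def optimalPlans {d : ℕ} (μ ν : P2 d) : Set (Measure (E d × E d)) :=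
  {γ | γ ∈ couplings μ ν ∧ ∀ γ' ∈ couplings μ ν, cost γ ≤ cost γ'}

/-- `W₂²(μ, ν)` as an infimum over couplings, with values in `[0, ∞]`. -/
noncomputable def infCost {d : ℕ} (μ ν : P2 d) : ℝ≥0∞ :=
  ⨅ γ ∈ couplings μ ν, cost γ

/-- The infimum is finite on `𝒫₂(ℝ^d)`, so that nothing is lost by passing to real values. -/
theorem infCost_lt_top {d : ℕ} (μ ν : P2 d) : infCost μ ν < ∞ := by
  have := μ.isProb
  have := ν.isProb
  have hmem : μ.toMeasure.prod ν.toMeasure ∈ couplings μ ν := by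
    constructor
    · simp [Measure.map_fst_prod]
    · simp [Measure.map_snd_prod]
  refine lt_of_le_of_lt (iInf₂_le _ hmem) ?_
  have h1 : MemLp (fun x : E d => x) 2 μ.toMeasure := by
    refine ⟨by fun_prop, ?_⟩
    rw [eLpNorm_lt_top_iff_lintegral_rpow_enorm_lt_top (by simp) (by simp)]
    simpa using μ.moment
  have h2 : MemLp (fun x : E d => x) 2 ν.toMeasure := by
    refine ⟨by fun_prop, ?_⟩
    rw [eLpNorm_lt_top_iff_lintegral_rpow_enorm_lt_top (by simp) (by simp)]
    simpa using ν.moment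
  have h3 := (h1.comp_fst ν.toMeasure).sub (h2.comp_snd μ.toMeasure)
  have h4 := (eLpNorm_lt_top_iff_lintegral_rpow_enorm_lt_top (by simp) (by simp)).1 h3.2
  simpa [cost] using h4

/-- The 2-Wasserstein distance on `𝒫₂(ℝ^d)`. -/
noncomputable def W2 {d : ℕ} (μ ν : P2 d) : ℝ :=
  Real.sqrt (infCost μ ν).toReal

/-- The curve `ρ` is a generalized geodesic between `μ₀` and `μ₁` with base `ν`:
`ρ t = ((1 - t) π² + t π³)_# γ` for a plan `γ ∈ Γ(ν, μ₀, μ₁)` whose `(1,2)` and `(1,3)` marginals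
are optimal. -/
def IsGeneralizedGeodesic {d : ℕ} (ν μ₀ μ₁ : P2 d) (ρ : unitInterval → P2 d) : Prop :=
  ∃ γ : Measure (E d × E d × E d),
    γ.map (fun p => p.1) = ν.toMeasure ∧
    γ.map (fun p => p.2.1) = μ₀.toMeasure ∧
    γ.map (fun p => p.2.2) = μ₁.toMeasure ∧
    γ.map (fun p => (p.1, p.2.1)) ∈ optimalPlans ν μ₀ ∧
    γ.map (fun p => (p.1, p.2.2)) ∈ optimalPlans ν μ₁ ∧
    ∀ t : unitInterval,
      (ρ t).toMeasure = γ.map (fun p => (1 - (t : ℝ)) • p.2.1 + (t : ℝ) • p.2.2)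

/-- Proper: values in `(-∞, +∞]`, not identically `+∞`. -/
def IsProper {d : ℕ} (G : P2 d → EReal) : Prop :=
  (∀ μ, G μ ≠ ⊥) ∧ ∃ μ, G μ ≠ ⊤

/-- Lower semicontinuity with respect to the distance `W₂`. -/
def IsLsc {d : ℕ} (G : P2 d → EReal) : Prop :=
  ∀ μ : P2 d, ∀ a : EReal, a < G μ → ∃ δ : ℝ, 0 < δ ∧ ∀ ν : P2 d, W2 ν μ < δ → a < G ν

/-- Convexity along generalized geodesics, with arbitrary base points `ν ∈ 𝒫₂(ℝ^d)`. -/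
def ConvexAlongGeneralizedGeodesics {d : ℕ} (G : P2 d → EReal) : Prop :=
  ∀ μ₀ μ₁ ν : P2 d, ∃ ρ : unitInterval → P2 d, IsGeneralizedGeodesic ν μ₀ μ₁ ρ ∧
    ∀ s : unitInterval,
      G (ρ s) ≤ ((1 - (s : ℝ) : ℝ) : EReal) * G μ₀ + ((s : ℝ) : EReal) * G μ₁

/-- The set of global minimizers of a functional on `𝒫₂(ℝ^d)`. -/
def argmin {d : ℕ} (F : P2 d → EReal) : Set (P2 d) :=
  {μ | ∀ ν, F μ ≤ F ν}

/-- The (a priori multivalued) JKO operator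
`μ ↦ argmin_ν { G(ν) + W₂²(ν, μ) / (2τ) }`. -/
noncomputable def jko {d : ℕ} (G : P2 d → EReal) (τ : ℝ) (μ : P2 d) : Set (P2 d) :=
  argmin fun ν => G ν + ((1 / (2 * τ) * W2 ν μ ^ 2 : ℝ) : EReal)

end JKO

open ProbabilityTheory

/-! ### Couplings as laws of random variables, and gluing. -/

namespace JKO

variable {d : ℕ}

/-! The core is strong convexity. Integrating the identity `norm_sub_convexCombination_sq` against a
three-plan with optimal (1,2) and (1,3) marginals shows that `W₂²(·, μ)` is 1-convex along
generalized geodesics with base `μ`; with the convexity of `G`, the penalized functional gains the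
term `t(1-t) W₂²(μ₀, μ₁)/(2τ)` (`exists_penalized_le`).

Existence: the functional is bounded below because `G` is. At `t = 1/2` the gain bounds the distance
between almost-minimizers by their excess, so minimizing sequences are Cauchy; completeness and
lower semicontinuity replace compactness. Completeness and the triangle inequality come from
realising consecutive couplings on one probability space and working in `L²`.

Variational inequality: compare the minimizer with the geodesic towards `ν`, divide by `t`, and let
`t → 0` (`sq_W2_le_of_mem_jko`). Testing it at another minimizer gives uniqueness; adding it for two
base points gives continuity. -/

lemma isProbabilityMeasure_of_mem_couplings {μ ν : P2 d} {γ : Measure (E d × E d)}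
    (h : γ ∈ couplings μ ν) : IsProbabilityMeasure γ := by
  have := μ.isProb
  rw [← h.1] at this
  exact Measure.isProbabilityMeasure_of_map Prod.fst

lemma memLp_id (μ : P2 d) : MemLp (fun x : E d => x) 2 μ.toMeasure := by
  refine ⟨by fun_prop, ?_⟩
  rw [eLpNorm_lt_top_iff_lintegral_rpow_enorm_lt_top (by simp) (by simp)]
  simpa using μ.moment

lemma sq_eLpNorm_two {Ω F : Type*} {_ : MeasurableSpace Ω} [NormedAddCommGroup F]
    (f : Ω → F) (P : Measure Ω) : eLpNorm f 2 P ^ 2 = ∫⁻ x, ‖f x‖ₑ ^ 2 ∂P := by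
  rw [eLpNorm_eq_lintegral_rpow_enorm_toReal (by simp) (by simp), ← ENNReal.rpow_natCast,
    ← ENNReal.rpow_mul]
  simp

lemma sq_W2 (μ ν : P2 d) : W2 μ ν ^ 2 = (infCost μ ν).toReal :=
  Real.sq_sqrt ENNReal.toReal_nonneg

lemma W2_nonneg (μ ν : P2 d) : 0 ≤ W2 μ ν := Real.sqrt_nonneg _

lemma ofReal_sq_W2 (μ ν : P2 d) : ENNReal.ofReal (W2 μ ν ^ 2) = infCost μ ν := by
  rw [sq_W2, ENNReal.ofReal_toReal (infCost_lt_top μ ν).ne]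

lemma infCost_le_lintegral {Ω : Type*} {_ : MeasurableSpace Ω} {P : Measure Ω} {X Y : Ω → E d}
    (hX : Measurable X) (hY : Measurable Y) {μ ν : P2 d} (hμ : P.map X = μ.toMeasure)
    (hν : P.map Y = ν.toMeasure) : infCost μ ν ≤ ∫⁻ ω, ‖X ω - Y ω‖ₑ ^ 2 ∂P := by
  have hXY : Measurable fun ω => (X ω, Y ω) := hX.prodMk hY
  have hmem : P.map (fun ω => (X ω, Y ω)) ∈ couplings μ ν := by
    constructor
    · rw [Measure.map_map measurable_fst hXY, ← hμ]; rfl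
    · rw [Measure.map_map measurable_snd hXY, ← hν]; rfl
  refine (iInf₂_le _ hmem).trans_eq ?_
  rw [cost, lintegral_map (by fun_prop) hXY]

/-- Any two random variables with laws `μ` and `ν` are at `L²`-distance at least `W₂(μ, ν)`. -/
lemma ofReal_W2_le_eLpNorm {Ω : Type*} {_ : MeasurableSpace Ω} {P : Measure Ω} {X Y : Ω → E d}
    (hX : Measurable X) (hY : Measurable Y) {μ ν : P2 d} (hμ : P.map X = μ.toMeasure)
    (hν : P.map Y = ν.toMeasure) : ENNReal.ofReal (W2 μ ν) ≤ eLpNorm (X - Y) 2 P := by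
  refine (ENNReal.pow_le_pow_left_iff two_ne_zero).1 ?_
  rw [sq_eLpNorm_two, ← ENNReal.ofReal_pow (W2_nonneg μ ν), ofReal_sq_W2]
  exact infCost_le_lintegral hX hY hμ hν

/-- Couplings that realise the distance up to an arbitrarily small error. -/
lemma exists_coupling_of_W2_lt {μ ν : P2 d} {r : ℝ} (h : W2 μ ν < r) :
    ∃ γ ∈ couplings μ ν, eLpNorm (fun z : E d × E d => z.1 - z.2) 2 γ < ENNReal.ofReal r := by
  have hr : 0 ≤ r := (W2_nonneg μ ν).trans h.le
  have hlt : infCost μ ν < ENNReal.ofReal r ^ 2 := by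
    rw [← ofReal_sq_W2, ← ENNReal.ofReal_pow hr]
    have := W2_nonneg μ ν
    exact (ENNReal.ofReal_lt_ofReal_iff (by nlinarith)).2 (by nlinarith)
  simp only [infCost, iInf_lt_iff] at hlt
  obtain ⟨γ, hγ, hcost⟩ := hlt
  refine ⟨γ, hγ, ?_⟩
  rw [cost, ← sq_eLpNorm_two] at hcost
  exact not_le.1 fun h => hcost.not_ge ((ENNReal.pow_le_pow_left_iff two_ne_zero).2 h)

/-- Gluing: a sequence of consecutive couplings is realised by a single stochastic process. -/
lemma exists_measure_map_eq_couplings (u : ℕ → P2 d) (γ : ℕ → Measure (E d × E d))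
    (hγ : ∀ n, γ n ∈ couplings (u n) (u (n + 1))) :
    ∃ P : Measure (ℕ → E d), IsProbabilityMeasure P ∧
      ∀ n, P.map (fun ω => (ω n, ω (n + 1))) = γ n := by
  have hprob : ∀ n, IsProbabilityMeasure (γ n) :=
    fun n => isProbabilityMeasure_of_mem_couplings (hγ n)
  have := (u 0).isProb
  -- A Markov chain: step `n` forgets all but the last coordinate and moves by the conditional law
  -- of `γ n`.
  let κ : (n : ℕ) → Kernel (Π _ : Finset.Iic n, E d) (E d) := fun n =>
    (γ n).condKernel.comap (fun x => x ⟨n, Finset.mem_Iic.2 le_rfl⟩) (by fun_prop)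
  let P : Measure (ℕ → E d) := Kernel.trajMeasure (X := fun _ => E d) (u 0).toMeasure κ
  have hstep : ∀ n, P.map (fun ω => ω n) = (u n).toMeasure →
      P.map (fun ω => (ω n, ω (n + 1))) = γ n := by
    intro n hn
    have h := Kernel.map_frestrictLe_trajMeasure_compProd_eq_map_trajMeasure
      (X := fun _ => E d) (μ₀ := (u 0).toMeasure) (κ := κ) (a := n)
    let e : (Π _ : Finset.Iic n, E d) → E d := fun x => x ⟨n, Finset.mem_Iic.2 le_rfl⟩
    have he : Measurable e := by fun_prop
    have hmap : P.map (fun ω => (ω n, ω (n + 1))) =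
        (P.map (Preorder.frestrictLe (π := fun _ => E d) n) ⊗ₘ κ n).map (Prod.map e id) := by
      rw [h, Measure.map_map (by fun_prop) (by fun_prop)]
      rfl
    rw [hmap, ← (γ n).disintegrate (γ n).condKernel]
    have hfst : (γ n).fst =
        (P.map (Preorder.frestrictLe (π := fun _ => E d) n)).map e := by
      rw [Measure.map_map he (by fun_prop), Measure.fst, (hγ n).1, ← hn]
      rfl
    rw [hfst]
    ext s hs
    rw [Measure.map_apply (by fun_prop) hs,
      Measure.compProd_apply (hs.preimage (by fun_prop)), Measure.compProd_apply hs,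
      lintegral_map (Kernel.measurable_kernel_prodMk_left hs) he]
    rfl
  have hmarg : ∀ n, P.map (fun ω => ω n) = (u n).toMeasure := by
    intro n
    induction n with
    | zero =>
      have h0 : P.map (fun ω => ω 0) = (P.map (Preorder.frestrictLe (π := fun _ => E d) 0)).map
          (MeasurableEquiv.piUnique (fun _ : Finset.Iic 0 => E d)) := by
        rw [Measure.map_map (by fun_prop) (by fun_prop)]
        rfl
      rw [h0, show P = Kernel.trajMeasure (X := fun _ => E d) (u 0).toMeasure κ from rfl,
        Kernel.trajMeasure, Measure.map_comp _ _ (by fun_prop),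
        Kernel.traj_map_frestrictLe, Kernel.partialTraj_self, Measure.id_comp,
        Measure.map_map (by fun_prop) (by fun_prop), MeasurableEquiv.self_comp_symm]
      exact Measure.map_id
    | succ n ih =>
      rw [← (hγ n).2, ← hstep n ih, Measure.map_map measurable_snd (by fun_prop)]
      rfl
  exact ⟨P, inferInstance, fun n => hstep n (hmarg n)⟩

end JKO

/-! ### `W₂` as a complete metric. -/

namespace JKO

variable {d : ℕ}

lemma W2_comm_le (μ ν : P2 d) : W2 ν μ ≤ W2 μ ν := by
  refine le_of_forall_gt_imp_ge_of_dense fun r hr => ?_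
  obtain ⟨γ, hγ, hlt⟩ := exists_coupling_of_W2_lt hr
  have h := ofReal_W2_le_eLpNorm measurable_snd measurable_fst hγ.2 hγ.1
  rw [eLpNorm_sub_comm] at h
  exact (ENNReal.ofReal_le_ofReal_iff ((W2_nonneg μ ν).trans hr.le)).1 (h.trans hlt.le)

lemma W2_comm (μ ν : P2 d) : W2 μ ν = W2 ν μ :=
  le_antisymm (W2_comm_le ν μ) (W2_comm_le μ ν)

lemma diagonal_mem_couplings (μ : P2 d) :
    μ.toMeasure.map (fun x => (x, x)) ∈ couplings μ μ := by
  constructor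
  · rw [Measure.map_map measurable_fst (by fun_prop)]
    exact Measure.map_id
  · rw [Measure.map_map measurable_snd (by fun_prop)]
    exact Measure.map_id

/-- If a process realises the couplings `γ n`, then its coordinates have the laws `u n`. -/
lemma map_eval_eq {u : ℕ → P2 d} {γ : ℕ → Measure (E d × E d)}
    (hγ : ∀ n, γ n ∈ couplings (u n) (u (n + 1))) {P : Measure (ℕ → E d)}
    (hP : ∀ n, P.map (fun ω => (ω n, ω (n + 1))) = γ n) (n : ℕ) :
    P.map (fun ω => ω n) = (u n).toMeasure := by
  rw [← (hγ n).1, ← hP n, Measure.map_map measurable_fst (by fun_prop)]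
  rfl

lemma eLpNorm_step_eq {γ : ℕ → Measure (E d × E d)} {P : Measure (ℕ → E d)}
    (hP : ∀ n, P.map (fun ω => (ω n, ω (n + 1))) = γ n) (n : ℕ) :
    eLpNorm ((fun ω : ℕ → E d => ω n) - fun ω => ω (n + 1)) 2 P =
      eLpNorm (fun z : E d × E d => z.1 - z.2) 2 (γ n) := by
  rw [← hP n, eLpNorm_map_measure (by fun_prop) (by fun_prop)]
  rfl

lemma W2_triangle (μ ν ρ : P2 d) : W2 μ ρ ≤ W2 μ ν + W2 ν ρ := by
  refine le_of_forall_pos_le_add fun ε hε => ?_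
  obtain ⟨γ₀, hγ₀, h₀⟩ := exists_coupling_of_W2_lt (lt_add_of_pos_right (W2 μ ν) (half_pos hε))
  obtain ⟨γ₁, hγ₁, h₁⟩ := exists_coupling_of_W2_lt (lt_add_of_pos_right (W2 ν ρ) (half_pos hε))
  -- Only times 0, 1, 2 matter; the chain is then kept constant by diagonal couplings.
  let u : ℕ → P2 d
    | 0 => μ
    | 1 => ν
    | _ + 2 => ρ
  let γ : ℕ → Measure (E d × E d)
    | 0 => γ₀
    | 1 => γ₁
    | _ + 2 => ρ.toMeasure.map fun x => (x, x)
  have hγ : ∀ n, γ n ∈ couplings (u n) (u (n + 1))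
    | 0 => hγ₀
    | 1 => hγ₁
    | _ + 2 => diagonal_mem_couplings ρ
  obtain ⟨P, -, hP⟩ := exists_measure_map_eq_couplings u γ hγ
  have hle := ofReal_W2_le_eLpNorm (X := fun ω : ℕ → E d => ω 0) (Y := fun ω => ω 2)
    (measurable_pi_apply 0) (measurable_pi_apply 2) (map_eval_eq hγ hP 0) (map_eval_eq hγ hP 2)
  have htri : eLpNorm ((fun ω : ℕ → E d => ω 0) - fun ω => ω 2) 2 P ≤
      ENNReal.ofReal (W2 μ ν + ε / 2) + ENNReal.ofReal (W2 ν ρ + ε / 2) := by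
    rw [← sub_add_sub_cancel (fun ω : ℕ → E d => ω 0) (fun ω => ω 1) (fun ω => ω 2)]
    refine (eLpNorm_add_le (Measurable.aestronglyMeasurable (by fun_prop))
      (Measurable.aestronglyMeasurable (by fun_prop)) (by norm_num)).trans
      (add_le_add ?_ ?_)
    · exact (eLpNorm_step_eq hP 0).trans_le h₀.le
    · exact (eLpNorm_step_eq hP 1).trans_le h₁.le
  have hμν := W2_nonneg μ ν
  have hνρ := W2_nonneg ν ρ
  rw [← ENNReal.ofReal_add (by positivity) (by positivity)] at htri
  have := (ENNReal.ofReal_le_ofReal_iff (by positivity)).1 (hle.trans htri)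
  linarith

lemma abs_W2_sub_W2_le (μ ν ρ : P2 d) : |W2 μ ρ - W2 ν ρ| ≤ W2 μ ν := by
  have h₁ := W2_triangle μ ν ρ
  have h₂ := W2_triangle ν μ ρ
  rw [W2_comm ν μ] at h₂
  exact abs_le.2 ⟨by linarith, by linarith⟩

/-- Completeness of `𝒫₂(ℝ^d)`, for sequences with geometrically decaying steps. -/
lemma exists_tendsto_of_W2_lt_geometric (u : ℕ → P2 d)
    (hu : ∀ n, W2 (u n) (u (n + 1)) < (1 / 2) ^ n) :
    ∃ ρ : P2 d, Tendsto (fun n => W2 (u n) ρ) atTop (𝓝 0) := by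
  choose γ hγ hlt using fun n => exists_coupling_of_W2_lt (hu n)
  obtain ⟨P, hprob, hP⟩ := exists_measure_map_eq_couplings u γ hγ
  let X : ℕ → (ℕ → E d) → E d := fun n ω => ω n
  have hXm : ∀ n, Measurable (X n) := measurable_pi_apply
  have hlaw : ∀ n, P.map (X n) = (u n).toMeasure := map_eval_eq hγ hP
  have hX : ∀ n, MemLp (X n) 2 P := fun n => by
    have h := memLp_id (u n)
    rw [← hlaw n] at h
    exact h.comp_of_map (hXm n).aemeasurable
  have hstep : ∀ n, eLpNorm (X n - X (n + 1)) 2 P < ENNReal.ofReal ((1 / 2) ^ n) := fun n =>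
    (eLpNorm_step_eq hP n).trans_lt (hlt n)
  -- The bound is the exact partial geometric sum, so that the induction closes.
  have hfar : ∀ N k, eLpNorm (X N - X (N + k)) 2 P ≤
      ENNReal.ofReal (2 * (1 / 2) ^ N - 2 * (1 / 2) ^ (N + k)) := by
    intro N k
    induction k with
    | zero => simp
    | succ k ih =>
      rw [← sub_add_sub_cancel (X N) (X (N + k)) (X (N + (k + 1)))]
      refine (eLpNorm_add_le ((hX _).sub (hX _)).1 ((hX _).sub (hX _)).1 (by norm_num)).trans
        ((add_le_add ih (hstep (N + k)).le).trans_eq ?_)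
      rw [← ENNReal.ofReal_add _ (by positivity)]
      · congr 1
        rw [← add_assoc, pow_succ]
        ring
      · have : ((1 : ℝ) / 2) ^ (N + k) ≤ (1 / 2) ^ N :=
          pow_le_pow_of_le_one (by norm_num) (by norm_num) (by omega)
        linarith
  have htail : ∀ N n, N ≤ n → eLpNorm (X N - X n) 2 P ≤ ENNReal.ofReal (2 * (1 / 2) ^ N) := by
    intro N n hn
    obtain ⟨k, rfl⟩ := Nat.exists_eq_add_of_le hn
    refine (hfar N k).trans (ENNReal.ofReal_le_ofReal ?_)
    have : (0 : ℝ) < (1 / 2) ^ (N + k) := by positivity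
    linarith
  have hsum : Summable fun n : ℕ => (5 : ℝ) * (1 / 2) ^ n :=
    summable_geometric_two.mul_left 5
  -- Two tails give `4 (1/2)^N`; the constant 5 makes the inequality strict.
  obtain ⟨f, hf, hlim⟩ := Lp.cauchy_complete_eLpNorm (p := 2) (by norm_num) hX
    (B := fun n => ENNReal.ofReal (5 * (1 / 2) ^ n)) hsum.tsum_ofReal_ne_top (by
      intro N n m hn hm
      rw [← sub_add_sub_cancel (X n) (X N) (X m)]
      refine (eLpNorm_add_le ((hX _).sub (hX _)).1 ((hX _).sub (hX _)).1
        (by norm_num)).trans_lt ?_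
      rw [eLpNorm_sub_comm]
      refine (add_le_add (htail N n hn) (htail N m hm)).trans_lt ?_
      have : (0 : ℝ) < (1 / 2) ^ N := by positivity
      rw [← ENNReal.ofReal_add (by positivity) (by positivity)]
      exact (ENNReal.ofReal_lt_ofReal_iff (by positivity)).2 (by linarith))
  let Y := hf.1.mk f
  have hYm : Measurable Y := hf.1.stronglyMeasurable_mk.measurable
  have hfY : f =ᵐ[P] Y := hf.1.ae_eq_mk
  have hY : MemLp Y 2 P := hf.ae_eq hfY
  let ρ : P2 d :=
    { toMeasure := P.map Y
      isProb := Measure.isProbabilityMeasure_map hYm.aemeasurable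
      moment := by
        rw [lintegral_map (by fun_prop) hYm, ← sq_eLpNorm_two]
        exact ENNReal.pow_lt_top hY.2 }
  refine ⟨ρ, ?_⟩
  have hle : ∀ n, ENNReal.ofReal (W2 (u n) ρ) ≤ eLpNorm (X n - f) 2 P := fun n => by
    rw [eLpNorm_congr_ae ((ae_eq_refl (X n)).sub hfY)]
    exact ofReal_W2_le_eLpNorm (hXm n) hYm (hlaw n) rfl
  have h0 : Tendsto (fun n => ENNReal.ofReal (W2 (u n) ρ)) atTop (𝓝 0) :=
    tendsto_of_tendsto_of_tendsto_of_le_of_le tendsto_const_nhds hlim (fun _ => zero_le) hle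
  have := (ENNReal.tendsto_toReal ENNReal.zero_ne_top).comp h0
  simpa [Function.comp_def, ENNReal.toReal_ofReal (W2_nonneg _ _)] using this

end JKO

/-! ### Strong convexity, existence of minimizers, variational inequality. -/

namespace JKO

variable {d : ℕ}

lemma cost_eq_infCost {μ ν : P2 d} {γ : Measure (E d × E d)} (h : γ ∈ optimalPlans μ ν) :
    cost γ = infCost μ ν :=
  le_antisymm (le_iInf₂ h.2) (iInf₂_le _ h.1)

lemma norm_sub_convexCombination_sq {F : Type*} [NormedAddCommGroup F] [InnerProductSpace ℝ F]
    (x y z : F) (t : ℝ) :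
    ‖x - ((1 - t) • y + t • z)‖ ^ 2 + t * (1 - t) * ‖y - z‖ ^ 2 =
      (1 - t) * ‖x - y‖ ^ 2 + t * ‖x - z‖ ^ 2 := by
  have h₁ : x - ((1 - t) • y + t • z) = (1 - t) • (x - y) + t • (x - z) := by module
  have h₂ : y - z = (x - z) - (x - y) := by abel
  rw [h₁, h₂, norm_add_sq_real, norm_sub_sq_real, norm_smul, norm_smul, inner_smul_left,
    inner_smul_right, real_inner_comm (x - y) (x - z), mul_pow, mul_pow, Real.norm_eq_abs,
    Real.norm_eq_abs, sq_abs, sq_abs]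
  simp only [conj_trivial]
  ring

lemma ofReal_norm_sq {F : Type*} [SeminormedAddCommGroup F] (x : F) :
    ENNReal.ofReal (‖x‖ ^ 2) = ‖x‖ₑ ^ 2 := by
  rw [ENNReal.ofReal_pow (norm_nonneg x), ofReal_norm]

/-- `W₂²(·, ν)` is `1`-convex along generalized geodesics with base `ν`. -/
lemma IsGeneralizedGeodesic.sq_W2_le {ν μ₀ μ₁ : P2 d} {ρ : unitInterval → P2 d}
    (h : IsGeneralizedGeodesic ν μ₀ μ₁ ρ) (s : unitInterval) :
    W2 (ρ s) ν ^ 2 + s * (1 - s) * W2 μ₀ μ₁ ^ 2 ≤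
      (1 - s) * W2 μ₀ ν ^ 2 + s * W2 μ₁ ν ^ 2 := by
  obtain ⟨γ, hν, h₀, h₁, hopt₀, hopt₁, hρ⟩ := h
  obtain ⟨t, ht0, ht1⟩ := s
  specialize hρ ⟨t, ht0, ht1⟩
  have ht1' : 0 ≤ 1 - t := by linarith
  have hc₀ := cost_eq_infCost hopt₀
  have hc₁ := cost_eq_infCost hopt₁
  rw [cost, lintegral_map (by fun_prop) (by fun_prop)] at hc₀ hc₁
  -- The plans induced for `(ν, ρ t)` and `(μ₀, μ₁)` need not be optimal, but both costs stand on
  -- the side where an upper bound for `infCost` suffices.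
  have hD := infCost_le_lintegral (P := γ) (X := fun p => p.1)
    (Y := fun p => (1 - t) • p.2.1 + t • p.2.2) (by fun_prop) (by fun_prop) hν hρ.symm
  have hC := infCost_le_lintegral (P := γ) (X := fun p => p.2.1) (Y := fun p => p.2.2)
    (by fun_prop) (by fun_prop) h₀ h₁
  have hid : (∫⁻ p, ‖p.1 - ((1 - t) • p.2.1 + t • p.2.2)‖ₑ ^ 2 ∂γ) +
      ENNReal.ofReal (t * (1 - t)) * ∫⁻ p, ‖p.2.1 - p.2.2‖ₑ ^ 2 ∂γ =
      ENNReal.ofReal (1 - t) * infCost ν μ₀ + ENNReal.ofReal t * infCost ν μ₁ := by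
    rw [← hc₀, ← hc₁, ← lintegral_const_mul _ (by fun_prop), ← lintegral_const_mul _ (by fun_prop),
      ← lintegral_const_mul _ (by fun_prop), ← lintegral_add_left (by fun_prop),
      ← lintegral_add_left (by fun_prop)]
    refine lintegral_congr fun p => ?_
    simp only [← ofReal_norm_sq]
    rw [← ENNReal.ofReal_mul (by positivity), ← ENNReal.ofReal_mul (by positivity),
      ← ENNReal.ofReal_mul (by positivity), ← ENNReal.ofReal_add (by positivity) (by positivity),
      ← ENNReal.ofReal_add (by positivity) (by positivity), norm_sub_convexCombination_sq]
  have hle := (add_le_add hD (mul_le_mul_right hC (ENNReal.ofReal (t * (1 - t))))).trans_eq hid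
  simp only [← ofReal_sq_W2] at hle
  rw [← ENNReal.ofReal_mul (by positivity), ← ENNReal.ofReal_mul (by positivity),
    ← ENNReal.ofReal_mul (by positivity), ← ENNReal.ofReal_add (by positivity) (by positivity),
    ← ENNReal.ofReal_add (by positivity) (by positivity),
    ENNReal.ofReal_le_ofReal_iff (by positivity)] at hle
  rw [W2_comm _ ν, W2_comm _ ν, W2_comm _ ν]
  exact hle

/-- An optimal plan of zero cost is concentrated on the diagonal. -/
lemma eq_of_W2_eq_zero {μ ν : P2 d} (hopt : (optimalPlans μ ν).Nonempty) (h : W2 μ ν = 0) :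
    μ = ν := by
  obtain ⟨γ, hγ⟩ := hopt
  have hcost : cost γ = 0 := by rw [cost_eq_infCost hγ, ← ofReal_sq_W2, h]; simp
  rw [cost, lintegral_eq_zero_iff (by fun_prop)] at hcost
  have hae : (Prod.fst : E d × E d → E d) =ᵐ[γ] Prod.snd := by
    filter_upwards [hcost] with z hz
    simpa [sub_eq_zero] using hz
  ext1
  rw [← hγ.1.1, ← hγ.1.2, Measure.map_congr hae]

/-- Generalized geodesics carry optimal plans by definition, so the convexity hypothesis already
contains their existence. -/
lemma ConvexAlongGeneralizedGeodesics.nonempty_optimalPlans {G : P2 d → EReal}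
    (hconv : ConvexAlongGeneralizedGeodesics G) (μ ν : P2 d) : (optimalPlans μ ν).Nonempty := by
  obtain ⟨_, ⟨_, -, -, -, hopt, -⟩, -⟩ := hconv ν ν μ
  exact ⟨_, hopt⟩

/-- The Moreau–Yosida functional at `ν`, where `a` is the value of the functional at `ν`. -/
noncomputable def penalized (τ : ℝ) (μ ν : P2 d) (a : ℝ) : ℝ :=
  a + 1 / (2 * τ) * W2 ν μ ^ 2

/-- Strong convexity of the penalized functional along generalized geodesics. -/
lemma exists_penalized_le {G : P2 d → EReal} (hbot : ∀ μ, G μ ≠ ⊥)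
    (hconv : ConvexAlongGeneralizedGeodesics G) {τ : ℝ} (hτ : 0 < τ) (μ : P2 d) {μ₀ μ₁ : P2 d}
    {a₀ a₁ : ℝ} (h₀ : G μ₀ = a₀) (h₁ : G μ₁ = a₁) {t : ℝ} (ht0 : 0 ≤ t) (ht1 : t ≤ 1) :
    ∃ (ρ : P2 d) (a : ℝ), G ρ = a ∧
      penalized τ μ ρ a + t * (1 - t) * (1 / (2 * τ) * W2 μ₀ μ₁ ^ 2) ≤
        (1 - t) * penalized τ μ μ₀ a₀ + t * penalized τ μ μ₁ a₁ := by
  obtain ⟨ρ, hρ, hG⟩ := hconv μ₀ μ₁ μ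
  specialize hG ⟨t, ht0, ht1⟩
  have hW := hρ.sq_W2_le ⟨t, ht0, ht1⟩
  simp only [h₀, h₁, ← EReal.coe_mul, ← EReal.coe_add] at hG hW
  have hfin : G (ρ ⟨t, ht0, ht1⟩) = ((G (ρ ⟨t, ht0, ht1⟩)).toReal : EReal) :=
    (EReal.coe_toReal (ne_top_of_le_ne_top (EReal.coe_ne_top _) hG) (hbot _)).symm
  refine ⟨_, _, hfin, ?_⟩
  rw [hfin, EReal.coe_le_coe_iff] at hG
  have := mul_le_mul_of_nonneg_left hW (show 0 ≤ 1 / (2 * τ) by positivity)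
  simp only [penalized]
  linarith

lemma exists_eq_coe_of_mem_argmin {G : P2 d → EReal} (hproper : IsProper G) {F : P2 d → EReal}
    {c : P2 d → ℝ} (hF : ∀ ν, F ν = G ν + (c ν : EReal)) {μ : P2 d} (hμ : μ ∈ argmin F) :
    ∃ a : ℝ, G μ = a := by
  obtain ⟨hbot, ν, hν⟩ := hproper
  refine ⟨(G μ).toReal, (EReal.coe_toReal (fun htop => ?_) (hbot μ)).symm⟩
  have h := hμ ν
  rw [hF, hF, htop, EReal.top_add_coe, top_le_iff] at h
  exact EReal.add_ne_top hν (EReal.coe_ne_top _) h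

/-- Competitors with `G = ⊤` never matter, so minimality can be tested in `ℝ`. -/
lemma mem_jko_iff {G : P2 d → EReal} (hbot : ∀ μ, G μ ≠ ⊥) {τ : ℝ} {μ ν : P2 d} {a : ℝ}
    (ha : G ν = a) :
    ν ∈ jko G τ μ ↔ ∀ (ρ : P2 d) (b : ℝ), G ρ = b → penalized τ μ ν a ≤ penalized τ μ ρ b := by
  constructor
  · intro h ρ b hb
    have := h ρ
    simp only [ha, hb, ← EReal.coe_add, EReal.coe_le_coe_iff] at this
    exact this
  · intro h ρ
    by_cases htop : G ρ = ⊤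
    · simp only [htop, EReal.top_add_coe, le_top]
    · have hb := (EReal.coe_toReal htop (hbot ρ)).symm
      have := h ρ _ hb
      simp only [ha]
      rw [hb, ← EReal.coe_add, ← EReal.coe_add, EReal.coe_le_coe_iff]
      exact this

lemma exists_mem_jko {G : P2 d → EReal} (hproper : IsProper G) (hlsc : IsLsc G)
    (hconv : ConvexAlongGeneralizedGeodesics G) (hmin : (argmin G).Nonempty) {τ : ℝ}
    (hτ : 0 < τ) (μ : P2 d) : (jko G τ μ).Nonempty := by
  obtain ⟨μ', hμ'⟩ := hmin
  obtain ⟨g, hg⟩ := exists_eq_coe_of_mem_argmin hproper (c := fun _ => 0) (fun ν => by simp) hμ'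
  have hbot := hproper.1
  let S : Set ℝ := {r | ∃ (ν : P2 d) (a : ℝ), G ν = a ∧ r = penalized τ μ ν a}
  have hSne : S.Nonempty := ⟨_, μ', g, hg, rfl⟩
  have hSbdd : BddBelow S := by
    refine ⟨g, ?_⟩
    rintro _ ⟨ν, a, ha, rfl⟩
    have h := hμ' ν
    rw [hg, ha, EReal.coe_le_coe_iff] at h
    have : 0 ≤ 1 / (2 * τ) * W2 ν μ ^ 2 := by positivity
    simp only [penalized]
    linarith
  let m := sInf S
  have hm : ∀ (ν : P2 d) (a : ℝ), G ν = a → m ≤ penalized τ μ ν a := fun ν a ha =>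
    csInf_le hSbdd ⟨ν, a, ha, rfl⟩
  -- The midpoint inequality gives `W₂²/(8τ) < ε n` for consecutive terms, hence `W₂² < (1/4)^n /
  -- 2`.
  let ε : ℕ → ℝ := fun n => 1 / (16 * τ) * (1 / 4) ^ n
  have hεpos : ∀ n, 0 < ε n := fun n => by positivity
  have hex : ∀ n, ∃ (ν : P2 d) (a : ℝ), G ν = a ∧ penalized τ μ ν a < m + ε n := fun n => by
    obtain ⟨_, ⟨ν, a, ha, rfl⟩, hlt⟩ := exists_lt_of_csInf_lt hSne (lt_add_of_pos_right m (hεpos n))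
    exact ⟨ν, a, ha, hlt⟩
  choose u a ha hu using hex
  have hstep : ∀ n, W2 (u n) (u (n + 1)) < (1 / 2) ^ n := by
    intro n
    obtain ⟨ρ, b, hb, hle⟩ := exists_penalized_le hbot hconv hτ μ (ha n) (ha (n + 1))
      (t := 1 / 2) (by norm_num) (by norm_num)
    have h₁ := hm ρ b hb
    have h₂ := hu n
    have h₃ := hu (n + 1)
    have h₄ : ε (n + 1) ≤ ε n := by
      have := hεpos n
      simp only [ε, pow_succ] at this ⊢
      linarith
    have h₅ : 1 / (8 * τ) * W2 (u n) (u (n + 1)) ^ 2 < 1 / (8 * τ) * (1 / 2 * (1 / 4) ^ n) := by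
      have e₁ : 1 / (8 * τ) * W2 (u n) (u (n + 1)) ^ 2 =
        1 / 2 * (1 - 1 / 2) * (1 / (2 * τ) * W2 (u n) (u (n + 1)) ^ 2) := by ring
      have e₂ : 1 / (8 * τ) * (1 / 2 * (1 / 4) ^ n) = ε n := by
        simp only [ε]; field_simp; norm_num
      rw [e₁, e₂]
      linarith
    have h₆ := lt_of_mul_lt_mul_left h₅ (by positivity)
    refine lt_of_pow_lt_pow_left₀ 2 (by positivity) ?_
    rw [← pow_mul, mul_comm n 2, pow_mul]
    have h₇ : (0 : ℝ) < (1 / 4) ^ n := by positivity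
    rw [show ((1 : ℝ) / 2) ^ 2 = 1 / 4 by norm_num]
    linarith
  obtain ⟨ρ, hρ⟩ := exists_tendsto_of_W2_lt_geometric u hstep
  have hW : Tendsto (fun n => W2 (u n) μ) atTop (𝓝 (W2 ρ μ)) := by
    rw [tendsto_iff_dist_tendsto_zero]
    exact squeeze_zero (fun _ => dist_nonneg) (fun n => abs_W2_sub_W2_le (u n) ρ μ) hρ
  have hε : Tendsto ε atTop (𝓝 0) := by
    have h := (tendsto_pow_atTop_nhds_zero_of_lt_one (r := (1 / 4 : ℝ)) (by norm_num)
      (by norm_num)).const_mul (1 / (16 * τ))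
    rwa [mul_zero] at h
  have hbound : Tendsto (fun n => m + ε n - 1 / (2 * τ) * W2 (u n) μ ^ 2) atTop
      (𝓝 (m - 1 / (2 * τ) * W2 ρ μ ^ 2)) := by
    simpa using (hε.const_add m).sub ((hW.pow 2).const_mul (1 / (2 * τ)))
  have hGρ : G ρ ≤ ((m - 1 / (2 * τ) * W2 ρ μ ^ 2 : ℝ) : EReal) := by
    by_contra hlt
    -- For large `n`, lower semicontinuity puts `G (u n)` above `c`, while almost-minimality puts it
    -- below.
    obtain ⟨c, hc₁, hc₂⟩ := EReal.lt_iff_exists_real_btwn.1 (not_le.1 hlt)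
    obtain ⟨δ, hδ, hδG⟩ := hlsc ρ c hc₂
    obtain ⟨n, hn₁, hn₂⟩ := ((hρ.eventually_lt_const hδ).and
      (hbound.eventually_lt_const (EReal.coe_lt_coe_iff.1 hc₁))).exists
    have h := hδG (u n) hn₁
    rw [ha n, EReal.coe_lt_coe_iff] at h
    have := hu n
    simp only [penalized] at this
    linarith
  have hfin := (EReal.coe_toReal (ne_top_of_le_ne_top (EReal.coe_ne_top _) hGρ) (hbot ρ)).symm
  refine ⟨ρ, (mem_jko_iff hbot hfin).2 fun ν b hb => le_trans ?_ (hm ν b hb)⟩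
  rw [hfin, EReal.coe_le_coe_iff] at hGρ
  simp only [penalized]
  linarith

/-- The evolution variational inequality, at points where the functional is finite. -/
lemma sq_W2_le_of_mem_jko {G : P2 d → EReal} (hbot : ∀ μ, G μ ≠ ⊥)
    (hconv : ConvexAlongGeneralizedGeodesics G) {τ : ℝ} (hτ : 0 < τ) {μ η ν : P2 d}
    (hη : η ∈ jko G τ μ) {a b : ℝ} (ha : G η = a) (hb : G ν = b) :
    W2 η ν ^ 2 - W2 μ ν ^ 2 ≤ 2 * τ * (b - a) - W2 η μ ^ 2 := by
  have hmin := (mem_jko_iff hbot ha).1 hη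
  have hineq : ∀ t : ℝ, 0 < t → t ≤ 1 → penalized τ μ η a + (1 - t) * (1 / (2 * τ) * W2 η ν ^ 2) ≤
      penalized τ μ ν b := by
    intro t ht0 ht1
    obtain ⟨ρ, c, hc, hle⟩ := exists_penalized_le hbot hconv hτ μ ha hb ht0.le ht1
    have := hmin ρ c hc
    refine le_of_mul_le_mul_left ?_ ht0
    linarith
  have hlim : Tendsto (fun t : ℝ => penalized τ μ η a + (1 - t) * (1 / (2 * τ) * W2 η ν ^ 2))
      (𝓝[>] 0) (𝓝 (penalized τ μ η a + (1 - 0) * (1 / (2 * τ) * W2 η ν ^ 2))) :=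
    tendsto_nhdsWithin_of_tendsto_nhds (Continuous.tendsto (by fun_prop) 0)
  have hle := le_of_tendsto hlim (by
    filter_upwards [Ioc_mem_nhdsGT one_pos] with t ht using hineq t ht.1 ht.2)
  simp only [penalized] at hle
  have h := mul_le_mul_of_nonneg_left hle (show 0 ≤ 2 * τ by positivity)
  field_simp at h
  rw [W2_comm μ ν]
  linarith

/-- The resolvent is continuous, as a consequence of the variational inequality. -/
lemma tendsto_of_evi {τ : ℝ} {J : P2 d → P2 d} {g : P2 d → ℝ}
    (hJ : ∀ μ ν, W2 (J μ) (J ν) ^ 2 - W2 μ (J ν) ^ 2 ≤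
      2 * τ * (g ν - g μ) - W2 (J μ) μ ^ 2)
    {u : ℕ → P2 d} {μ : P2 d} (hu : Tendsto (fun n => W2 (u n) μ) atTop (𝓝 0)) :
    Tendsto (fun n => W2 (J (u n)) (J μ)) atTop (𝓝 0) := by
  set B := W2 (J μ) μ with hB
  have hB0 : 0 ≤ B := W2_nonneg _ _
  have hbound : ∀ n, W2 (J (u n)) (J μ) ≤ 2 * W2 (u n) μ + √(2 * W2 (u n) μ * B) := by
    intro n
    have h₁ := hJ (u n) μ
    have h₂ := hJ μ (u n)
    have t₁ := W2_triangle (u n) μ (J μ)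
    have t₂ := W2_triangle μ (u n) (J (u n))
    have t₃ := W2_triangle (J (u n)) (J μ) μ
    have t₄ := W2_triangle (J (u n)) μ (u n)
    rw [W2_comm (J μ) (J (u n))] at h₂
    rw [W2_comm μ (J μ)] at t₁
    rw [W2_comm (u n) (J (u n)), W2_comm μ (u n)] at t₂
    rw [W2_comm μ (u n)] at t₄
    rw [W2_comm (J (u n)) μ] at t₃ t₄
    have ha := W2_nonneg (J (u n)) (J μ)
    have he := W2_nonneg (u n) μ
    have hp := W2_nonneg (J (u n)) (u n)
    have hr := W2_nonneg (u n) (J μ)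
    have hq := W2_nonneg μ (J (u n))
    rw [← hB] at *
    generalize W2 (J (u n)) (J μ) = a at *
    generalize W2 (u n) μ = e at *
    generalize W2 (J (u n)) (u n) = p at *
    generalize W2 (u n) (J μ) = r at *
    generalize W2 μ (J (u n)) = q at *
    have hs := Real.sq_sqrt (show 0 ≤ 2 * e * B by positivity)
    have hs0 := Real.sqrt_nonneg (2 * e * B)
    generalize √(2 * e * B) = s at *
    have k₁ : r ^ 2 ≤ (e + B) ^ 2 := pow_le_pow_left₀ hr t₁ 2
    have k₂ : q ^ 2 ≤ (e + p) ^ 2 := pow_le_pow_left₀ hq t₂ 2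
    have k₃ : e * p ≤ e * (a + B + e) := mul_le_mul_of_nonneg_left (by linarith) he
    -- In `h₁ + h₂` the values of `g` cancel, and `-B²`, `-p²` absorb the squares from `k₁`, `k₂`;
    -- here `s² = 2eB`. If `a > 2e + s`, then `a(a - e) > (2e + s)(e + s) ≥ 2e² + s²`, a
    -- contradiction.
    have k₄ : a ^ 2 ≤ 2 * e ^ 2 + s ^ 2 + e * a := by linarith
    by_contra! hlt
    nlinarith [mul_pos (show 0 < a - 2 * e - s by linarith) (show 0 < a by linarith),
      mul_nonneg he hs0, mul_nonneg (show 0 ≤ e + s by positivity)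
        (show 0 ≤ a - 2 * e - s by linarith)]
  have hz : Tendsto (fun n => 2 * W2 (u n) μ + √(2 * W2 (u n) μ * B)) atTop (𝓝 0) := by
    simpa using (hu.const_mul 2).add (((hu.const_mul 2).mul_const B).sqrt)
  exact squeeze_zero (fun _ => W2_nonneg _ _) hbound hz

end JKO

theorem theorem2p10 (d : ℕ) (G : JKO.P2 d → EReal)
    (hproper : JKO.IsProper G) (hlsc : JKO.IsLsc G)
    (hconv : JKO.ConvexAlongGeneralizedGeodesics G) (hmin : (JKO.argmin G).Nonempty)
    (τ : ℝ) (hτ : 0 < τ) :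
    ∃ J : JKO.P2 d → JKO.P2 d,
      (∀ μ, JKO.jko G τ μ = {J μ}) ∧
      (∀ μ ν, ((JKO.W2 (J μ) ν ^ 2 - JKO.W2 μ ν ^ 2 : ℝ) : EReal) ≤
        ((2 * τ : ℝ) : EReal) * (G ν - G (J μ)) - ((JKO.W2 (J μ) μ ^ 2 : ℝ) : EReal)) ∧
      (∀ (u : ℕ → JKO.P2 d) (μ : JKO.P2 d),
        Tendsto (fun n => JKO.W2 (u n) μ) atTop (𝓝 0) →
        Tendsto (fun n => JKO.W2 (J (u n)) (J μ)) atTop (𝓝 0)) := by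
  have hbot := hproper.1
  choose J hJ using JKO.exists_mem_jko hproper hlsc hconv hmin hτ
  have hfin : ∀ {μ ν}, ν ∈ JKO.jko G τ μ → ∃ a : ℝ, G ν = a := fun h =>
    JKO.exists_eq_coe_of_mem_argmin hproper (fun _ => rfl) h
  choose g hg using fun μ => hfin (hJ μ)
  refine ⟨J, fun μ => ?_, fun μ ν => ?_, fun u μ hu => ?_⟩
  · refine Set.eq_singleton_iff_unique_mem.2 ⟨hJ μ, fun η hη => ?_⟩
    obtain ⟨b, hb⟩ := hfin hη
    -- Tested at `η`, the inequality bounds `W₂²(J μ, η)` by `2τ` times the difference of the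
    -- penalized values, which is at most 0.
    have h₁ := JKO.sq_W2_le_of_mem_jko hbot hconv hτ (hJ μ) (hg μ) hb
    have h₂ := (JKO.mem_jko_iff hbot hb).1 hη _ _ (hg μ)
    have h₃ := mul_le_mul_of_nonneg_left h₂ (show 0 ≤ 2 * τ by positivity)
    simp only [JKO.penalized] at h₃
    field_simp at h₃
    rw [JKO.W2_comm μ η] at h₁
    have h₄ : JKO.W2 η (J μ) = 0 := by
      rw [JKO.W2_comm]
      exact pow_eq_zero_iff two_ne_zero |>.1 (le_antisymm (by linarith) (sq_nonneg _))
    exact JKO.eq_of_W2_eq_zero (hconv.nonempty_optimalPlans _ _) h₄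
  · by_cases htop : G ν = ⊤
    · rw [htop, hg, EReal.top_sub_coe, EReal.coe_mul_top_of_pos (by positivity), EReal.top_sub_coe]
      exact le_top
    · have hb := (EReal.coe_toReal htop (hbot ν)).symm
      rw [hb, hg]
      exact_mod_cast JKO.sq_W2_le_of_mem_jko hbot hconv hτ (hJ μ) (hg μ) hb
  · exact JKO.tendsto_of_evi
      (fun μ ν => JKO.sq_W2_le_of_mem_jko hbot hconv hτ (hJ μ) (hg μ) (hg ν)) hu
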